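/- Let $M,n\in\mathbb N$, let $A_1,\dots,A_M\in\mathbb R^{n\times n}$ and $b_1,\dots,b_M\in\mathbb R^n$. Let $\mathcal S$ be the set of all right-continuous functions $\sigma:[0,\infty)\to\{1,\dots,M\}$ having finitely many discontinuity points in every bounded interval. For $\sigma\in\mathcal S$, $x\in\mathbb R^n$ and $t\ge 0$, let $\Psi_\sigma(t,x)$ be the value at time $t$ of the solution of the switched affine system $\dot x(t)=A_{\sigma(t)}x(t)+b_{\sigma(t)}$ with $x(0)=x$, and let $\Phi_\sigma(t,0)x$ be the value at time $t$ of the solution of its linearization $\dot x(t)=A_{\sigma(t)}x(t)$ with $x(0)=x$. A set $C\subset\mathbb R^n$ is called forward invariant (for the switched affine system on $\mathcal S$) if $\Psi_\sigma(t,x)\in C$ for all $x\in C$, all $\sigma\in\mathcal S$ and all $t\ge 0$. Suppose that the linearization is unstable on $\mathcal S$, i.e. there exist $x\in\mathbb R^n$ and $\sigma\in\mathcal S$ such that $\limsup_{t\to\infty}|\Phi_\sigma(t,0)x|=+\infty$. Then there is no compact forward invariant set $C\subset\mathbb R^n$ with nonempty interior. If, moreover, $\{A_1,\dots,A_M\}$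 is irreducible, i.e. $\{0\}$ and $\mathbb R^n$ are the only linear subspaces of $\mathbb R^n$ that are invariant under all the matrices $A_1,\dots,A_M$, then there is no nonempty compact forward invariant set $C\subset\mathbb R^n$ other than a singleton. -/

import Mathlib

open Filter Topology Set
open scoped NNReal Matrix

namespace SwitchedAffine

/-- The class `𝒮` of switching signals: right-continuous functions `σ : [0, ∞) → ⟨M⟩` that are
piecewise constant, that is, have finitely many discontinuity points in every bounded interval. -/
structure SwitchingSignal (M : ℕ) where
  toFun : ℝ≥0 → Fin M
  finite_discontinuities : ∀ T : ℝ≥0, {t : ℝ≥0 | t ≤ T ∧ ¬ ContinuousAt toFun t}.Finite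
  right_continuous : ∀ t : ℝ≥0, ContinuousWithinAt toFun (Ici t) t

/-- The affine vector field `x ↦ A x + b` on `ℝⁿ`. -/
noncomputable def affineField {n : ℕ} (A : Matrix (Fin n) (Fin n) ℝ) (b : EuclideanSpace ℝ (Fin n))
    (x : EuclideanSpace ℝ (Fin n)) : EuclideanSpace ℝ (Fin n) :=
  Matrix.toEuclideanLin A x + b

/-- `φ`, restricted to `[0, ∞)`, is the solution of `ẋ(t) = A_{σ(t)} x(t) + b_{σ(t)}`, `x(0) = x`:
it is continuous, starts at `x`, and satisfies the equation at every time, with the right derivative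
(the signal is right-continuous and piecewise constant, so this is the same as the equation with the
two-sided derivative at all times but the switching instants). -/
structure IsSolution {M n : ℕ} (A : Fin M → Matrix (Fin n) (Fin n) ℝ)
    (b : Fin M → EuclideanSpace ℝ (Fin n)) (σ : SwitchingSignal M)
    (x : EuclideanSpace ℝ (Fin n)) (φ : ℝ → EuclideanSpace ℝ (Fin n)) : Prop where
  initial : φ 0 = x
  continuousOn : ContinuousOn φ (Ici 0)
  hasDeriv : ∀ t : ℝ≥0, HasDerivWithinAt φ
    (affineField (A (σ.toFun t)) (b (σ.toFun t)) (φ t)) (Ici (t : ℝ)) t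

section Existence

variable {M n : ℕ}

theorem exists_autonomous (A : Matrix (Fin n) (Fin n) ℝ) (b x : EuclideanSpace ℝ (Fin n)) :
    ∃ ψ : ℝ → EuclideanSpace ℝ (Fin n), ψ 0 = x ∧
      ∀ t, HasDerivAt ψ (affineField A b (ψ t)) t := by
  let L : EuclideanSpace ℝ (Fin n) →L[ℝ] EuclideanSpace ℝ (Fin n) :=
    LinearMap.toContinuousLinearMap (Matrix.toEuclideanLin A)
  let B : (EuclideanSpace ℝ (Fin n) × ℝ) →L[ℝ] (EuclideanSpace ℝ (Fin n) × ℝ) :=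
    (L.comp (ContinuousLinearMap.fst ℝ _ _) +
      (ContinuousLinearMap.snd ℝ _ _).smulRight b).prod 0
  let z : ℝ → EuclideanSpace ℝ (Fin n) × ℝ := fun t => NormedSpace.exp (t • B) (x, 1)
  have hz : ∀ t, HasDerivAt z (B (z t)) t := by
    intro t
    have h := hasDerivAt_exp_smul_const' (𝕂 := ℝ) B t
    exact h.clm_apply (hasDerivAt_const t ((x, 1) : EuclideanSpace ℝ (Fin n) × ℝ)) |>.congr_deriv
      (by simp [z])
  have h0 : z 0 = (x, 1) := by
    change NormedSpace.exp ((0 : ℝ) • B) (x, 1) = (x, 1)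
    rw [zero_smul ℝ B, NormedSpace.exp_zero]
    rfl
  have hs : ∀ t, (z t).2 = 1 := by
    have hd : ∀ t, HasDerivAt (fun t => (z t).2) 0 t := fun t => (hz t).snd
    intro t
    have := is_const_of_deriv_eq_zero (fun t => (hd t).differentiableAt) (fun t => (hd t).deriv) t 0
    simpa [h0] using this
  refine ⟨fun t => (z t).1, by simp [h0], fun t => ?_⟩
  have h1 : HasDerivAt (fun t => (z t).1) (B (z t)).1 t := (hz t).fst
  refine h1.congr_deriv ?_
  simp [B, L, affineField, hs]

theorem SwitchingSignal.exists_right (σ : SwitchingSignal M) (t : ℝ) (ht : 0 ≤ t) :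
    ∃ d, t < d ∧ ∀ s ∈ Ico t d, σ.toFun s.toNNReal = σ.toFun t.toNNReal := by
  have h1 : ∀ᶠ s in 𝓝[≥] t.toNNReal, σ.toFun s = σ.toFun t.toNNReal :=
    (σ.right_continuous t.toNNReal).eventually
      (p := fun j => j = σ.toFun t.toNNReal) (by simp)
  have h2 : Tendsto Real.toNNReal (𝓝[≥] t) (𝓝[≥] t.toNNReal) :=
    tendsto_nhdsWithin_of_tendsto_nhds_of_eventually_within _
      (continuous_real_toNNReal.continuousAt.mono_left nhdsWithin_le_nhds)
      (eventually_mem_nhdsWithin.mono fun s hs => Real.toNNReal_le_toNNReal hs)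
  obtain ⟨d, hd, hsub⟩ := mem_nhdsGE_iff_exists_Ico_subset.1 (h2.eventually h1)
  exact ⟨d, hd, fun s hs => hsub hs⟩

theorem SwitchingSignal.exists_left (σ : SwitchingSignal M) (t : ℝ) (ht : 0 < t) :
    ∃ c, 0 ≤ c ∧ c < t ∧ ∃ i, ∀ s ∈ Ico c t, σ.toFun s.toNNReal = i := by
  let D : Set ℝ := (fun s : ℝ≥0 => (s : ℝ)) ''
    {s : ℝ≥0 | s ≤ t.toNNReal ∧ ¬ ContinuousAt σ.toFun s}
  have hD : D.Finite := (σ.finite_discontinuities t.toNNReal).image _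
  have h1 : ∀ᶠ s in 𝓝[<] t, s ∉ D := by
    have : ∀ᶠ s in 𝓝 t, s ∉ D \ {t} :=
      (hD.subset sdiff_subset).isClosed.isOpen_compl.eventually_mem (by simp)
    filter_upwards [nhdsWithin_le_nhds this, self_mem_nhdsWithin] with s hs hst hsD
    exact hs ⟨hsD, ne_of_lt hst⟩
  obtain ⟨c, hc, hsub⟩ := (mem_nhdsLT_iff_exists_Ioo_subset' ht).1
    (h1.and (Ioo_mem_nhdsLT ht))
  have hct : c < t := hc
  have hcont : ContinuousOn (fun s : ℝ => σ.toFun s.toNNReal) (Ioo c t) := by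
    intro s hs
    have hs' := hsub hs
    have hs0 : 0 ≤ s := hs'.2.1.le
    have : ContinuousAt σ.toFun s.toNNReal := by
      by_contra hne
      exact hs'.1 ⟨s.toNNReal, ⟨Real.toNNReal_le_toNNReal hs.2.le, hne⟩, Real.coe_toNNReal s hs0⟩
    exact (ContinuousAt.comp (f := Real.toNNReal) this
      continuous_real_toNNReal.continuousAt).continuousWithinAt
  have hmid : (c + t) / 2 ∈ Ioo c t := ⟨by linarith, by linarith⟩
  refine ⟨(c + t) / 2, (hsub hmid).2.1.le, hmid.2, σ.toFun ((c + t) / 2).toNNReal, fun s hs => ?_⟩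
  exact isPreconnected_Ioo.constant hcont ⟨by linarith [hs.1, hmid.1], hs.2⟩ hmid

/-- `φ` solves the switched affine system on `[0, T]`. -/
def IsSolutionUpTo (A : Fin M → Matrix (Fin n) (Fin n) ℝ)
    (b : Fin M → EuclideanSpace ℝ (Fin n)) (σ : SwitchingSignal M)
    (x : EuclideanSpace ℝ (Fin n)) (T : ℝ) (φ : ℝ → EuclideanSpace ℝ (Fin n)) : Prop :=
  φ 0 = x ∧ ContinuousOn φ (Icc 0 T) ∧ ∀ t ∈ Ico 0 T, HasDerivWithinAt φ
    (affineField (A (σ.toFun t.toNNReal)) (b (σ.toFun t.toNNReal)) (φ t)) (Ici t) t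

theorem IsSolutionUpTo.mono {A : Fin M → Matrix (Fin n) (Fin n) ℝ}
    {b : Fin M → EuclideanSpace ℝ (Fin n)} {σ : SwitchingSignal M}
    {x : EuclideanSpace ℝ (Fin n)} {S T : ℝ} {φ : ℝ → EuclideanSpace ℝ (Fin n)}
    (h : IsSolutionUpTo A b σ x T φ) (hST : S ≤ T) : IsSolutionUpTo A b σ x S φ :=
  ⟨h.1, h.2.1.mono (Icc_subset_Icc_right hST), fun t ht => h.2.2 t ⟨ht.1, ht.2.trans_le hST⟩⟩

theorem IsSolutionUpTo.extend {A : Fin M → Matrix (Fin n) (Fin n) ℝ}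
    {b : Fin M → EuclideanSpace ℝ (Fin n)} {σ : SwitchingSignal M}
    {x : EuclideanSpace ℝ (Fin n)} {c d : ℝ} {φ : ℝ → EuclideanSpace ℝ (Fin n)}
    (h : IsSolutionUpTo A b σ x c φ) (hc : 0 ≤ c) (hcd : c ≤ d) {i : Fin M}
    (hi : ∀ s ∈ Ico c d, σ.toFun s.toNNReal = i) :
    ∃ χ, IsSolutionUpTo A b σ x d χ := by
  obtain ⟨ψ, hψ0, hψ⟩ := exists_autonomous (A i) (b i) (φ c)
  let χ : ℝ → EuclideanSpace ℝ (Fin n) := fun t => if t ≤ c then φ t else ψ (t - c)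
  have hl : ∀ t ≤ c, χ t = φ t := fun t ht => if_pos ht
  have hr : ∀ t, c ≤ t → χ t = ψ (t - c) := by
    intro t ht
    rcases ht.eq_or_lt with rfl | ht
    · simp [χ, hψ0]
    · exact if_neg (not_le.2 ht)
  have hψc : ∀ t, HasDerivAt (fun s => ψ (s - c)) (affineField (A i) (b i) (ψ (t - c))) t :=
    fun t => HasDerivAt.comp_sub_const t c (hψ (t - c))
  refine ⟨χ, by rw [hl 0 hc, h.1], ?_, fun t ht => ?_⟩
  · rw [← Icc_union_Icc_eq_Icc hc hcd]
    refine ContinuousOn.union_of_isClosed (h.2.1.congr fun t ht => hl t ht.2) ?_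
      isClosed_Icc isClosed_Icc
    exact ContinuousOn.congr (f := fun s => ψ (s - c))
      (fun t _ => (hψc t).continuousAt.continuousWithinAt) fun t ht => hr t ht.1
  · rcases lt_or_ge t c with htc | htc
    · rw [hl t htc.le]
      refine (h.2.2 t ⟨ht.1, htc⟩).congr_of_eventuallyEq ?_ (hl t htc.le)
      filter_upwards [nhdsWithin_le_nhds (Iic_mem_nhds htc)] with s hs using hl s hs
    · rw [hr t htc, hi t ⟨htc, ht.2⟩]
      exact (hψc t).hasDerivWithinAt.congr (fun s hs => hr s (htc.trans hs)) (hr t htc)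

theorem exists_isSolutionUpTo (A : Fin M → Matrix (Fin n) (Fin n) ℝ)
    (b : Fin M → EuclideanSpace ℝ (Fin n)) (σ : SwitchingSignal M)
    (x : EuclideanSpace ℝ (Fin n)) (T : ℝ) : ∃ φ, IsSolutionUpTo A b σ x T φ := by
  by_contra hT
  let S : Set ℝ := {s | ∃ φ, IsSolutionUpTo A b σ x s φ}
  have h0 : (0 : ℝ) ∈ S := ⟨fun _ => x, rfl, continuousOn_const, fun t ht => by simp at ht⟩
  have hlt : ∀ s ∈ S, s < T := fun s ⟨φ, hφ⟩ => not_le.1 fun hTs => hT ⟨φ, hφ.mono hTs⟩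
  have hbdd : BddAbove S := ⟨T, fun s hs => (hlt s hs).le⟩
  have hs0 : 0 ≤ sSup S := le_csSup hbdd h0
  have hsup : sSup S ∈ S := by
    rcases hs0.eq_or_lt with h | h
    · rwa [← h]
    · obtain ⟨c, hc0, hc, i, hi⟩ := σ.exists_left _ h
      obtain ⟨r, ⟨φ, hφ⟩, hr⟩ := exists_lt_of_lt_csSup ⟨0, h0⟩ hc
      exact (hφ.mono hr.le).extend hc0 hc.le hi
  obtain ⟨φ, hφ⟩ := hsup
  obtain ⟨d, hd, hi⟩ := σ.exists_right _ hs0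
  exact absurd (le_csSup hbdd (hφ.extend hs0 hd.le hi)) (not_le.2 hd)

theorem IsSolutionUpTo.eqOn {A : Fin M → Matrix (Fin n) (Fin n) ℝ}
    {b : Fin M → EuclideanSpace ℝ (Fin n)} {σ : SwitchingSignal M}
    {x : EuclideanSpace ℝ (Fin n)} {T : ℝ} {φ χ : ℝ → EuclideanSpace ℝ (Fin n)}
    (hφ : IsSolutionUpTo A b σ x T φ) (hχ : IsSolutionUpTo A b σ x T χ) :
    EqOn φ χ (Icc 0 T) := by
  let L : Fin M → EuclideanSpace ℝ (Fin n) →L[ℝ] EuclideanSpace ℝ (Fin n) :=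
    fun i => LinearMap.toContinuousLinearMap (Matrix.toEuclideanLin (A i))
  let K : ℝ≥0 := ∑ i, ‖L i‖₊
  have hv : ∀ t : ℝ, LipschitzWith K
      (affineField (A (σ.toFun t.toNNReal)) (b (σ.toFun t.toNNReal))) := by
    intro t
    have h1 : LipschitzWith ‖L (σ.toFun t.toNNReal)‖₊
        (affineField (A (σ.toFun t.toNNReal)) (b (σ.toFun t.toNNReal))) := by
      refine LipschitzWith.of_dist_le_mul fun y z => ?_
      have := (L (σ.toFun t.toNNReal)).lipschitz.dist_le_mul y z
      simpa [affineField, L] using this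
    exact h1.weaken (Finset.single_le_sum (f := fun i => ‖L i‖₊) (fun _ _ => zero_le)
      (Finset.mem_univ _))
  exact ODE_solution_unique hv hφ.2.1 hφ.2.2 hχ.2.1 hχ.2.2 (hφ.1.trans hχ.1.symm)

theorem IsSolution.isSolutionUpTo {A : Fin M → Matrix (Fin n) (Fin n) ℝ}
    {b : Fin M → EuclideanSpace ℝ (Fin n)} {σ : SwitchingSignal M}
    {x : EuclideanSpace ℝ (Fin n)} {φ : ℝ → EuclideanSpace ℝ (Fin n)}
    (h : IsSolution A b σ x φ) (T : ℝ) : IsSolutionUpTo A b σ x T φ := by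
  refine ⟨h.initial, h.continuousOn.mono Icc_subset_Ici_self, fun t ht => ?_⟩
  have := h.hasDeriv t.toNNReal
  rwa [Real.coe_toNNReal t ht.1] at this

/-- Existence of the solution. -/
theorem exists_isSolution (A : Fin M → Matrix (Fin n) (Fin n) ℝ)
    (b : Fin M → EuclideanSpace ℝ (Fin n)) (σ : SwitchingSignal M)
    (x : EuclideanSpace ℝ (Fin n)) : ∃ φ, IsSolution A b σ x φ := by
  choose f hf using exists_isSolutionUpTo A b σ x
  have key : ∀ T, ∀ t ∈ Icc 0 T, f (t + 1) t = f T t := by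
    intro T t ht
    rcases le_total (t + 1) T with h | h
    · exact (hf (t + 1)).eqOn ((hf T).mono h) ⟨ht.1, by linarith⟩
    · exact ((hf (t + 1)).mono h).eqOn (hf T) ht
  refine ⟨fun t => f (t + 1) t, (hf _).1, fun t ht => ?_, fun t => ?_⟩
  · have ht0 : 0 ≤ t := ht
    have h1 : ContinuousWithinAt (f (t + 1)) (Icc 0 (t + 1)) t :=
      (hf (t + 1)).2.1 t ⟨ht0, by linarith⟩
    have h2 : Icc 0 (t + 1) ∈ 𝓝[Ici 0] t := by
      filter_upwards [self_mem_nhdsWithin, nhdsWithin_le_nhds (Iic_mem_nhds (lt_add_one t))]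
        with s hs hs' using ⟨hs, hs'⟩
    refine (h1.mono_of_mem_nhdsWithin h2).congr_of_eventuallyEq ?_ rfl
    filter_upwards [h2] with s hs using key _ s hs
  · have h1 := (hf ((t : ℝ) + 1)).2.2 t ⟨t.2, lt_add_one _⟩
    rw [Real.toNNReal_coe] at h1
    refine h1.congr_of_eventuallyEq ?_ rfl
    filter_upwards [self_mem_nhdsWithin, nhdsWithin_le_nhds (Iic_mem_nhds (lt_add_one (t : ℝ)))]
      with s hs hs' using key _ s ⟨t.2.trans hs, hs'⟩

end Existence

/-- The flow map `Ψ_σ(t, x)`: the solution of `ẋ(t) = A_{σ(t)} x(t) + b_{σ(t)}`, `x(0) = x`,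
evaluated at time `t ≥ 0`. -/
noncomputable def flow {M n : ℕ} (A : Fin M → Matrix (Fin n) (Fin n) ℝ)
    (b : Fin M → EuclideanSpace ℝ (Fin n)) (σ : SwitchingSignal M) (t : ℝ≥0)
    (x : EuclideanSpace ℝ (Fin n)) : EuclideanSpace ℝ (Fin n) :=
  (exists_isSolution A b σ x).choose t

/-- Uniqueness: every solution coincides with the flow map at all times `t ≥ 0`. -/
theorem IsSolution.eq_flow {M n : ℕ} {A : Fin M → Matrix (Fin n) (Fin n) ℝ}
    {b : Fin M → EuclideanSpace ℝ (Fin n)} {σ : SwitchingSignal M}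
    {x : EuclideanSpace ℝ (Fin n)} {φ : ℝ → EuclideanSpace ℝ (Fin n)}
    (h : IsSolution A b σ x φ) (t : ℝ≥0) : φ t = flow A b σ t x :=
  (h.isSolutionUpTo t).eqOn ((exists_isSolution A b σ x).choose_spec.isSolutionUpTo t)
    ⟨t.2, le_rfl⟩

/-- `Φ_σ(t, 0) x`, where `Φ_σ` is the state-transition matrix of the linearization
`ẋ(t) = A_{σ(t)} x(t)`: the solution of the linearization starting at `x`, at time `t ≥ 0`. -/
noncomputable def linearizedFlow {M n : ℕ} (A : Fin M → Matrix (Fin n) (Fin n) ℝ)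
    (σ : SwitchingSignal M) (t : ℝ≥0) (x : EuclideanSpace ℝ (Fin n)) :
    EuclideanSpace ℝ (Fin n) :=
  flow A (fun _ => 0) σ t x

/-- The linearization is unstable on `𝒮`: `limsup_{t → ∞} |Φ_σ(t, 0) x| = +∞` for some `x ∈ ℝⁿ` and
some `σ ∈ 𝒮`; the limit superior is taken in the extended reals. -/
def UnstableLinearization {M n : ℕ} (A : Fin M → Matrix (Fin n) (Fin n) ℝ) : Prop :=
  ∃ (x : EuclideanSpace ℝ (Fin n)) (σ : SwitchingSignal M),
    limsup (fun t : ℝ≥0 => ((‖linearizedFlow A σ t x‖ : ℝ) : EReal)) atTop = ⊤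

/-- `C` is forward invariant for the switched affine system on `𝒮`. -/
def ForwardInvariant {M n : ℕ} (A : Fin M → Matrix (Fin n) (Fin n) ℝ)
    (b : Fin M → EuclideanSpace ℝ (Fin n)) (C : Set (EuclideanSpace ℝ (Fin n))) : Prop :=
  ∀ x ∈ C, ∀ (σ : SwitchingSignal M) (t : ℝ≥0), flow A b σ t x ∈ C

/-- The set of matrices `{A_1, …, A_M}` is irreducible: `{0}` and `ℝⁿ` are the only subspaces of
`ℝⁿ` that are invariant under all the `A_i`. -/
def IrreducibleFamily {M n : ℕ} (A : Fin M → Matrix (Fin n) (Fin n) ℝ) : Prop :=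
  ∀ V : Submodule ℝ (EuclideanSpace ℝ (Fin n)),
    (∀ i, ∀ v ∈ V, Matrix.toEuclideanLin (A i) v ∈ V) → V = ⊥ ∨ V = ⊤

end SwitchedAffine

namespace SwitchedAffine

variable {M n : ℕ}

/-! Let V be the set of states v for which Φ_σ(t,0)v is bounded uniformly in σ and t
(`boundedSubspace`). By linearity V is a subspace. Two affine trajectories driven by the same signal
differ by a trajectory of the linearization, so x - y ∈ V for all x, y in a bounded forward
invariant set C. If C has interior, V contains a neighbourhood of 0, hence V = ℝⁿ, which instability
forbids.

V is also invariant under every A_i. Running mode i for time τ before σ is again an admissible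
signal, so the uniformity in σ gives e^{τA_i}V ⊆ V; differentiating at τ = 0 gives A_i V ⊆ V. Under
irreducibility V is thus {0} or ℝⁿ; instability excludes ℝⁿ, and V = {0} forces C to be a singleton.
-/

theorem IsSolution.add_smul {A : Fin M → Matrix (Fin n) (Fin n) ℝ}
    {b b' : Fin M → EuclideanSpace ℝ (Fin n)} {σ : SwitchingSignal M}
    {x y : EuclideanSpace ℝ (Fin n)} {φ χ : ℝ → EuclideanSpace ℝ (Fin n)}
    (hφ : IsSolution A b σ x φ) (c : ℝ) (hχ : IsSolution A b' σ y χ) :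
    IsSolution A (fun i => b i + c • b' i) σ (x + c • y) (fun t => φ t + c • χ t) where
  initial := by rw [hφ.initial, hχ.initial]
  continuousOn := hφ.continuousOn.add (hχ.continuousOn.const_smul c)
  hasDeriv t := by
    refine ((hφ.hasDeriv t).add ((hχ.hasDeriv t).const_smul c)).congr_deriv ?_
    simp only [affineField, map_add, map_smul, smul_add]
    abel

theorem isSolution_flow (A : Fin M → Matrix (Fin n) (Fin n) ℝ)
    (b : Fin M → EuclideanSpace ℝ (Fin n)) (σ : SwitchingSignal M)
    (x : EuclideanSpace ℝ (Fin n)) :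
    IsSolution A b σ x (exists_isSolution A b σ x).choose :=
  (exists_isSolution A b σ x).choose_spec

theorem linearizedFlow_add_smul (A : Fin M → Matrix (Fin n) (Fin n) ℝ) (σ : SwitchingSignal M)
    (t : ℝ≥0) (x y : EuclideanSpace ℝ (Fin n)) (c : ℝ) :
    linearizedFlow A σ t (x + c • y) = linearizedFlow A σ t x + c • linearizedFlow A σ t y := by
  have h := (isSolution_flow A (fun _ => 0) σ x).add_smul c (isSolution_flow A (fun _ => 0) σ y)
  simp only [smul_zero, add_zero] at h
  exact (h.eq_flow t).symm

theorem linearizedFlow_zero (A : Fin M → Matrix (Fin n) (Fin n) ℝ) (σ : SwitchingSignal M)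
    (t : ℝ≥0) : linearizedFlow A σ t 0 = 0 := by
  -- With coefficient -1, Φ(0) = Φ(0) - Φ(0).
  simpa using linearizedFlow_add_smul A σ t 0 0 (-1)

/-- The affine terms cancel because both trajectories follow the same signal. -/
theorem linearizedFlow_sub (A : Fin M → Matrix (Fin n) (Fin n) ℝ)
    (b : Fin M → EuclideanSpace ℝ (Fin n)) (σ : SwitchingSignal M) (t : ℝ≥0)
    (x y : EuclideanSpace ℝ (Fin n)) :
    linearizedFlow A σ t (x - y) = flow A b σ t x - flow A b σ t y := by
  have h := (isSolution_flow A b σ x).add_smul (-1) (isSolution_flow A b σ y)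
  simp only [neg_smul, one_smul, add_neg_cancel, ← sub_eq_add_neg] at h
  exact (h.eq_flow t).symm

/-! ### Concatenation of a constant mode with a signal -/

/-- The signal that equals `i` on `[0, τ)` and then follows `σ`. -/
noncomputable def SwitchingSignal.precede (i : Fin M) (τ : ℝ≥0) (σ : SwitchingSignal M) :
    SwitchingSignal M where
  toFun t := if t < τ then i else σ.toFun (t - τ)
  finite_discontinuities T := by
    -- The only candidates are τ itself and the translates by τ of discontinuities of σ.
    refine (((σ.finite_discontinuities T).image (· + τ)).insert τ).subset ?_
    rintro t ⟨htT, ht⟩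
    rcases lt_trichotomy t τ with h | h | h
    · refine (ht ?_).elim
      refine (continuousAt_const (y := i)).congr ?_
      filter_upwards [Iio_mem_nhds h] with s hs using (if_pos hs).symm
    · exact Or.inl h
    · refine Or.inr ⟨t - τ, ⟨tsub_le_self.trans htT, fun hc => ht ?_⟩, tsub_add_cancel_of_le h.le⟩
      have h1 : ContinuousAt (fun s => σ.toFun (s - τ)) t :=
        ContinuousAt.comp (f := fun s : ℝ≥0 => s - τ) hc
          (continuous_id.sub continuous_const).continuousAt
      refine h1.congr ?_
      filter_upwards [Ioi_mem_nhds h] with s hs using (if_neg (not_lt.2 (le_of_lt hs))).symm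
  right_continuous t := by
    rcases lt_or_ge t τ with h | h
    · refine ContinuousAt.continuousWithinAt ?_
      refine (continuousAt_const (y := i)).congr ?_
      filter_upwards [Iio_mem_nhds h] with s hs using (if_pos hs).symm
    · have h1 : ContinuousWithinAt (fun s => σ.toFun (s - τ)) (Ici t) t :=
        (σ.right_continuous (t - τ)).comp (f := fun s : ℝ≥0 => s - τ)
          (continuous_id.sub continuous_const).continuousWithinAt
          fun s hs => tsub_le_tsub_right hs τ
      exact h1.congr (fun s hs => if_neg (not_lt.2 (h.trans hs))) (if_neg (not_lt.2 h))

theorem IsSolution.precede {A : Fin M → Matrix (Fin n) (Fin n) ℝ}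
    {b : Fin M → EuclideanSpace ℝ (Fin n)} {σ : SwitchingSignal M} {i : Fin M}
    {ψ φ : ℝ → EuclideanSpace ℝ (Fin n)} {τ : ℝ≥0}
    (hψ : ∀ t, HasDerivAt ψ (affineField (A i) (b i) (ψ t)) t)
    (hφ : IsSolution A b σ (ψ τ) φ) :
    IsSolution A b (σ.precede i τ) (ψ 0) (fun t => if t ≤ τ then ψ t else φ (t - τ)) := by
  have hl : ∀ t : ℝ, t ≤ τ → (if t ≤ τ then ψ t else φ (t - τ)) = ψ t := fun t ht => if_pos ht
  -- The two branches agree at t = τ since φ 0 = ψ τ. The second formula therefore holds on all of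
  -- [τ, ∞), which gives the right derivative at τ.
  have hr : ∀ t : ℝ, τ ≤ t → (if t ≤ τ then ψ t else φ (t - τ)) = φ (t - τ) := by
    intro t ht
    rcases ht.eq_or_lt with rfl | ht
    · simp [hφ.initial]
    · exact if_neg (not_le.2 ht)
  refine ⟨hl 0 τ.2, ?_, fun t => ?_⟩
  · rw [← Icc_union_Ici_eq_Ici τ.2]
    refine ContinuousOn.union_of_isClosed
      (ContinuousOn.congr (f := ψ) (fun t _ => (hψ t).continuousAt.continuousWithinAt)
        fun t ht => hl t ht.2) ?_ isClosed_Icc isClosed_Ici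
    refine ContinuousOn.congr (f := fun t => φ (t - τ)) ?_ fun t ht => hr t ht
    exact hφ.continuousOn.comp (continuous_id.sub continuous_const).continuousOn
      fun t (ht : (τ : ℝ) ≤ t) => show (0 : ℝ) ≤ t - τ from sub_nonneg.2 ht
  · rcases lt_or_ge t τ with h | h
    · have h' : (t : ℝ) < τ := h
      have hσ : (σ.precede i τ).toFun t = i := if_pos h
      simp only [hσ, hl t h'.le]
      refine (hψ t).hasDerivWithinAt.congr_of_eventuallyEq ?_ (hl t h'.le)
      filter_upwards [nhdsWithin_le_nhds (Iic_mem_nhds h')] with s hs using hl s hs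
    · have h' : (τ : ℝ) ≤ t := h
      have hσ : (σ.precede i τ).toFun t = σ.toFun (t - τ) := if_neg (not_lt.2 h)
      simp only [hσ, hr t h']
      have hd := hφ.hasDeriv (t - τ)
      rw [NNReal.coe_sub h] at hd
      have h1 : HasDerivWithinAt (fun s : ℝ => s - τ) 1 (Ici (t : ℝ)) t :=
        ((hasDerivAt_id (t : ℝ)).sub_const (τ : ℝ)).hasDerivWithinAt
      have h2 := HasDerivWithinAt.scomp (t : ℝ) hd h1
        (fun s (hs : (t : ℝ) ≤ s) => show (t : ℝ) - τ ≤ s - τ by linarith)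
      rw [one_smul] at h2
      exact h2.congr (fun s hs => hr s (h'.trans hs)) (hr t h')

/-! ### The subspace of uniformly bounded initial states -/

/-- The initial states from which the linearization is bounded, uniformly in the signal. -/
def boundedSubspace (A : Fin M → Matrix (Fin n) (Fin n) ℝ) :
    Submodule ℝ (EuclideanSpace ℝ (Fin n)) where
  carrier := {v | ∃ K : ℝ, ∀ (σ : SwitchingSignal M) (t : ℝ≥0), ‖linearizedFlow A σ t v‖ ≤ K}
  zero_mem' := ⟨0, fun σ t => by simp [linearizedFlow_zero]⟩
  add_mem' := by
    rintro v w ⟨K, hK⟩ ⟨L, hL⟩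
    refine ⟨K + L, fun σ t => ?_⟩
    have h := linearizedFlow_add_smul A σ t v w 1
    rw [one_smul, one_smul] at h
    rw [h]
    exact norm_add_le_of_le (hK σ t) (hL σ t)
  smul_mem' := by
    rintro c v ⟨K, hK⟩
    refine ⟨|c| * K, fun σ t => ?_⟩
    have h := linearizedFlow_add_smul A σ t 0 v c
    rw [zero_add, linearizedFlow_zero, zero_add] at h
    rw [h, norm_smul, Real.norm_eq_abs]
    exact mul_le_mul_of_nonneg_left (hK σ t) (abs_nonneg c)

/-- The mode-i trajectory from v stays in the subspace, with the same bound K, because its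
continuations under σ are tails of trajectories from v. Its derivative at 0 is A_i v, a limit of
difference quotients lying in a closed subspace. -/
theorem apply_mem_boundedSubspace (A : Fin M → Matrix (Fin n) (Fin n) ℝ) (i : Fin M)
    {v : EuclideanSpace ℝ (Fin n)} (hv : v ∈ boundedSubspace A) :
    Matrix.toEuclideanLin (A i) v ∈ boundedSubspace A := by
  obtain ⟨ψ, hψ0, hψ⟩ := exists_autonomous (A i) 0 v
  have hmem : ∀ τ : ℝ, 0 ≤ τ → ψ τ ∈ boundedSubspace A := by
    intro τ hτ
    lift τ to ℝ≥0 using hτ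
    obtain ⟨K, hK⟩ := hv
    refine ⟨K, fun σ t => ?_⟩
    have h1 := (isSolution_flow A (fun _ => 0) σ (ψ τ)).precede (i := i) hψ
    have h2 := h1.eq_flow (t + τ)
    have h3 := hK (σ.precede i τ) (t + τ)
    rw [← hψ0, linearizedFlow, ← h2] at h3
    -- At t = 0 the glued trajectory is evaluated at τ, where the conditional selects the branch ψ.
    rcases eq_or_ne t 0 with rfl | ht
    · have h4 := (isSolution_flow A (fun _ => 0) σ (ψ τ)).initial
      rw [if_pos (by simp)] at h3
      change ‖(exists_isSolution A (fun _ => 0) σ (ψ τ)).choose 0‖ ≤ K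
      rw [h4]
      simpa using h3
    · have : 0 < (t : ℝ) := by positivity
      rw [if_neg (by push_cast; linarith), NNReal.coe_add, add_sub_cancel_right] at h3
      exact h3
  have hclosed : IsClosed (boundedSubspace A : Set (EuclideanSpace ℝ (Fin n))) :=
    (boundedSubspace A).closed_of_finiteDimensional
  -- Only right slopes are used, as membership is known for τ ≥ 0 only.
  have hd := (hψ 0).hasDerivWithinAt (s := Ioi 0)
  rw [hasDerivWithinAt_iff_tendsto_slope' (by simp)] at hd
  rw [hψ0, affineField, add_zero] at hd
  refine hclosed.mem_of_tendsto hd ?_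
  filter_upwards [self_mem_nhdsWithin] with s hs
  rw [slope_def_module]
  exact (boundedSubspace A).smul_mem _ ((boundedSubspace A).sub_mem (hmem s (le_of_lt hs))
    (hmem 0 le_rfl))

/-- Both trajectories remain in C, so a bound on distances within C serves for every signal and
time. -/
theorem sub_mem_boundedSubspace {A : Fin M → Matrix (Fin n) (Fin n) ℝ}
    {b : Fin M → EuclideanSpace ℝ (Fin n)} {C : Set (EuclideanSpace ℝ (Fin n))}
    (hC : Bornology.IsBounded C) (hinv : ForwardInvariant A b C) {x y : EuclideanSpace ℝ (Fin n)}
    (hx : x ∈ C) (hy : y ∈ C) : x - y ∈ boundedSubspace A := by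
  obtain ⟨K, hK⟩ := Metric.isBounded_iff.1 hC
  refine ⟨K, fun σ t => ?_⟩
  rw [linearizedFlow_sub A b, ← dist_eq_norm]
  exact hK (hinv x hx σ t) (hinv y hy σ t)

theorem UnstableLinearization.boundedSubspace_ne_top {A : Fin M → Matrix (Fin n) (Fin n) ℝ}
    (h : UnstableLinearization A) : boundedSubspace A ≠ ⊤ := by
  intro htop
  obtain ⟨x, σ, hx⟩ := h
  obtain ⟨K, hK⟩ : x ∈ boundedSubspace A := htop ▸ Submodule.mem_top
  have hle : limsup (fun t : ℝ≥0 => ((‖linearizedFlow A σ t x‖ : ℝ) : EReal)) atTop ≤ (K : EReal) :=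
    limsup_le_of_le (by isBoundedDefault) (Eventually.of_forall fun t => by exact_mod_cast hK σ t)
  rw [hx, top_le_iff] at hle
  exact EReal.coe_ne_top K hle

theorem boundedSubspace_eq_top_of_interior {A : Fin M → Matrix (Fin n) (Fin n) ℝ}
    {b : Fin M → EuclideanSpace ℝ (Fin n)} {C : Set (EuclideanSpace ℝ (Fin n))}
    (hC : Bornology.IsBounded C) (hinv : ForwardInvariant A b C) (hint : (interior C).Nonempty) :
    boundedSubspace A = ⊤ := by
  obtain ⟨c, hc⟩ := hint
  have hcC := interior_subset hc
  -- For an interior point c of C, every small v is a difference (c + v) - c of points of C.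
  refine Submodule.eq_top_of_nonempty_interior' _ ⟨0, ?_⟩
  rw [mem_interior_iff_mem_nhds]
  have h1 : Tendsto (fun v => c + v) (𝓝 0) (𝓝 c) := by
    simpa only [add_zero] using (continuous_const_add c).tendsto 0
  filter_upwards [h1 (mem_interior_iff_mem_nhds.1 hc)] with v hv
  have := sub_mem_boundedSubspace hC hinv hv hcC
  rwa [add_sub_cancel_left] at this

end SwitchedAffine

theorem mainTheorem4 (M n : ℕ) (A : Fin M → Matrix (Fin n) (Fin n) ℝ)
    (b : Fin M → EuclideanSpace ℝ (Fin n))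
    (hunstable : SwitchedAffine.UnstableLinearization A) :
    (¬ ∃ C : Set (EuclideanSpace ℝ (Fin n)), IsCompact C ∧
      SwitchedAffine.ForwardInvariant A b C ∧ (interior C).Nonempty) ∧
    (SwitchedAffine.IrreducibleFamily A →
      ¬ ∃ C : Set (EuclideanSpace ℝ (Fin n)), C.Nonempty ∧ IsCompact C ∧
        SwitchedAffine.ForwardInvariant A b C ∧ ¬ ∃ x, C = {x}) := by
  refine ⟨?_, ?_⟩
  · rintro ⟨C, hC, hinv, hint⟩
    exact hunstable.boundedSubspace_ne_top
      (SwitchedAffine.boundedSubspace_eq_top_of_interior hC.isBounded hinv hint)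
  · rintro hirr ⟨C, hne, hC, hinv, hsing⟩
    rcases hirr (SwitchedAffine.boundedSubspace A)
      (fun i _ hv => SwitchedAffine.apply_mem_boundedSubspace A i hv) with h | h
    · obtain ⟨x, hx⟩ := hne
      refine hsing ⟨x, Set.eq_singleton_iff_unique_mem.2 ⟨hx, fun y hy => ?_⟩⟩
      have hyx := SwitchedAffine.sub_mem_boundedSubspace hC.isBounded hinv hy hx
      rw [h, Submodule.mem_bot] at hyx
      exact sub_eq_zero.1 hyx
    · exact hunstable.boundedSubspace_ne_top h
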